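/- A \emph{bipartite graph} $\Gamma=(V_1,E,V_2)$ consists of a finite set $E$ of edges and finite sets $V_1$ of left and $V_2$ of right vertices, every edge $e$ joining a vertex $V_1(e)\in V_1$ to a vertex $V_2(e)\in V_2$; multiple edges are allowed and there are no isolated vertices. Its degree is $|\Gamma|=|E|$. Isomorphisms preserve the two sides, and $\mathrm{Aut}(\Gamma)$ is regarded as a group of permutations of $E$. Let $B_n$ be the complex vector space whose basis is the finite set of isomorphism classes of bipartite graphs of degree $n\ge 0$, and let $B_\infty=\bigoplus_{n\ge0}B_n$. \emph{Product on $B_n$.} Let $\Gamma=(V_1,E,V_2)$ and $\Gamma'=(V_1',E',V_2')$ have degree $n$. A \emph{gluing} is a pair $(\chi,F)$ of a valency-preserving map $\chi:V_2\to V_1'$ and a subset $F\subset E\times E'$ that projects bijectively onto $E$ and onto $E'$ and satisfies $\chi(V_2(e))=V_1'(e')$ for all $(e,e')\in F$. It gives the bipartite graph $(V_1,\overline F,V_2')$ whose edges are the pairs $(e,e')\in F$, joining $V_1(e)$ to $V_2'(e')$. Let $\mathrm{Aut}_F(V_1,\overline F,V_2')$ be the subgroup of those automorphisms of this graph that induce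 on $E$ an automorphism of $\Gamma$. Two gluings are equivalent if they are carried to each other by an element of $\mathrm{Aut}(\Gamma)\times\mathrm{Aut}(\Gamma')$. The bilinear product $*$ on $B_n$ is given by $$[\Gamma]*[\Gamma']=\sum_{(\chi,F)}\frac{|\mathrm{Aut}(V_1,\overline F,V_2')|}{|\mathrm{Aut}_F(V_1,\overline F,V_2')|}\,[(V_1,\overline F,V_2')],$$ the sum being over the equivalence classes of gluings. \emph{Extension.} A bipartite graph is \emph{simple} if each of its connected components has exactly two vertices. A \emph{standard extension} of degree $n$ of a graph $\Gamma$ of degree $m\le n$ is a disjoint union $\tilde\Gamma=\Gamma\sqcup S$ with $S=\tilde\Gamma\setminus\Gamma$ a simple graph of degree $n-m$. The linear map $\rho_n:B_m\to B_n$ is given by $$\rho_n(\Gamma)=\sum_{\tilde\Gamma}\frac{|\mathrm{Aut}(\tilde\Gamma)|}{|\mathrm{Aut}(\Gamma)|\,|\mathrm{Aut}(\tilde\Gamma\setminus\Gamma)|}\,\tilde\Gamma ,$$ the sum being over the isomorphism classes of standard extensions of degree $n$. \emph{Product on $B_\infty$.} For graphs $\Gamma_1,\Gamma_2$ and $n\ge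 M:=\max\{|\Gamma_1|,|\Gamma_2|\}$ define $\{\Gamma_1\Gamma_2\}_n\in B_n$ recursively by $$\{\Gamma_1\Gamma_2\}_n=\rho_n(\Gamma_1)*\rho_n(\Gamma_2)-\sum_{k=M}^{n-1}\rho_n(\{\Gamma_1\Gamma_2\}_k)$$ (for $n=M$ the sum is empty), and let $\circ$ be the bilinear product on $B_\infty$ with $\Gamma_1\circ\Gamma_2=\sum_{n\ge M}\{\Gamma_1\Gamma_2\}_n$. \textbf{Lemma.} For all bipartite graphs $\Gamma_1,\Gamma_2$ one has $\{\Gamma_1\Gamma_2\}_n=0$ for $n>|\Gamma_1|+|\Gamma_2|$ (so the sum defining $\Gamma_1\circ\Gamma_2$ is finite), and the product $\circ$ on $B_\infty$ is associative. -/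

import Mathlib

open Finset

noncomputable section

namespace BipartiteGraphs

/-- A bipartite multigraph `(V₁, E, V₂)` with edge set `E` and without isolated vertices: two
edges are related by `left` (by `right`) iff they share their vertex in `V₁` (in `V₂`). As every
vertex is the end of an edge, the vertex sets are the quotients `V₁` and `V₂` below. -/
structure BipGraph (E : Type) where
  left : Setoid E
  right : Setoid E

namespace BipGraph

variable {E E' D D' : Type}

/-- The set of left vertices. -/
abbrev V₁ (Γ : BipGraph E) : Type := Quotient Γ.left

/-- The set of right vertices. -/
abbrev V₂ (Γ : BipGraph E) : Type := Quotient Γ.right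

/-- The left vertex of an edge. -/
def end₁ (Γ : BipGraph E) (e : E) : Γ.V₁ := Quotient.mk Γ.left e

/-- The right vertex of an edge. -/
def end₂ (Γ : BipGraph E) (e : E) : Γ.V₂ := Quotient.mk Γ.right e

/-- The valency of a left vertex. -/
def valency₁ (Γ : BipGraph E) (v : Γ.V₁) : ℕ := Nat.card {e : E // Γ.end₁ e = v}

/-- The valency of a right vertex. -/
def valency₂ (Γ : BipGraph E) (v : Γ.V₂) : ℕ := Nat.card {e : E // Γ.end₂ e = v}

/-- A bijection between the edge sets is (the edge part of) an isomorphism of bipartite graphs: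
it respects the relations of having a common left or a common right vertex. The bijections of
the vertex sets are determined by it. -/
def IsIso (Γ : BipGraph E) (Δ : BipGraph D) (a : E ≃ D) : Prop :=
  ∀ e f, (Γ.end₁ e = Γ.end₁ f ↔ Δ.end₁ (a e) = Δ.end₁ (a f)) ∧
    (Γ.end₂ e = Γ.end₂ f ↔ Δ.end₂ (a e) = Δ.end₂ (a f))

/-- The order of the automorphism group of a bipartite graph. -/
def autCard (Γ : BipGraph E) : ℕ := Nat.card {a : E ≃ E // Γ.IsIso Γ a}

theorem IsIso.refl (Γ : BipGraph E) : Γ.IsIso Γ (Equiv.refl E) := fun _ _ => by simp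

theorem IsIso.symm {Γ : BipGraph E} {Δ : BipGraph D} {a : E ≃ D} (h : Γ.IsIso Δ a) :
    Δ.IsIso Γ a.symm := fun e f => by
  have := h (a.symm e) (a.symm f)
  simp only [Equiv.apply_symm_apply] at this
  exact ⟨this.1.symm, this.2.symm⟩

theorem IsIso.trans {Γ : BipGraph E} {Δ : BipGraph D} {Θ : BipGraph D'} {a : E ≃ D}
    {b : D ≃ D'} (h : Γ.IsIso Δ a) (h' : Δ.IsIso Θ b) : Γ.IsIso Θ (a.trans b) :=
  fun e f => ⟨(h e f).1.trans (h' _ _).1, (h e f).2.trans (h' _ _).2⟩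

theorem autCard_congr {Γ : BipGraph E} {Δ : BipGraph D} {a : E ≃ D} (h : Γ.IsIso Δ a) :
    Γ.autCard = Δ.autCard := by
  refine Nat.card_congr
    { toFun := fun u => ⟨(a.symm.trans u.1).trans a, (h.symm.trans u.2).trans h⟩
      invFun := fun u => ⟨(a.trans u.1).trans a.symm, (h.trans u.2).trans h.symm⟩
      left_inv := fun u => ?_
      right_inv := fun u => ?_ } <;>
  · apply Subtype.ext; ext; simp

/-- A graph is simple if all its connected components have exactly two vertices: any two edges
in one connected component (a class of the join of the two relations) have the same ends. -/
def IsSimple (Γ : BipGraph E) : Prop :=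
  ∀ e f, (Γ.left ⊔ Γ.right) e f → Γ.end₁ e = Γ.end₁ f ∧ Γ.end₂ e = Γ.end₂ f

/-- The disjoint union of two bipartite graphs. -/
def disjUnion (Γ : BipGraph E) (Δ : BipGraph D) : BipGraph (E ⊕ D) where
  left := Setoid.ker (Sum.map Γ.end₁ Δ.end₁)
  right := Setoid.ker (Sum.map Γ.end₂ Δ.end₂)

/-- Renaming the edges along a bijection. -/
def relabel (Γ : BipGraph E) (a : E ≃ D) : BipGraph D where
  left := Γ.left.comap a.symm
  right := Γ.right.comap a.symm

@[simp] theorem end₁_eq (Γ : BipGraph E) {e f : E} : Γ.end₁ e = Γ.end₁ f ↔ Γ.left e f :=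
  Quotient.eq

@[simp] theorem end₂_eq (Γ : BipGraph E) {e f : E} : Γ.end₂ e = Γ.end₂ f ↔ Γ.right e f :=
  Quotient.eq

theorem relabel_isIso (Γ : BipGraph E) (a : E ≃ D) : Γ.IsIso (Γ.relabel a) a :=
  fun e f => by simp [relabel, Setoid.comap_rel]

theorem disjUnion_isIso {Γ : BipGraph E} {Δ : BipGraph D} {Γ' : BipGraph E'} {Δ' : BipGraph D'}
    {a : E ≃ E'} {b : D ≃ D'} (h : Γ.IsIso Γ' a) (h' : Δ.IsIso Δ' b) :
    (Γ.disjUnion Δ).IsIso (Γ'.disjUnion Δ') (a.sumCongr b) := by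
  rintro (e | e) (f | f) <;>
  simp only [end₁_eq, end₂_eq, disjUnion, Setoid.ker_def, Sum.map_inl, Sum.map_inr,
    Equiv.sumCongr_apply, Sum.inl.injEq, Sum.inr.injEq, reduceCtorEq, iff_self, and_self]
  · simpa using h e f
  · simpa using h' e f

theorem IsSimple.of_iso {Γ : BipGraph E} {Δ : BipGraph D} {a : E ≃ D} (h : Γ.IsIso Δ a)
    (hs : Γ.IsSimple) : Δ.IsSimple := by
  have key : Δ.left ⊔ Δ.right ≤ (Γ.left ⊔ Γ.right).comap a.symm := by
    refine sup_le ?_ ?_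
    · intro e f hef
      exact (le_sup_left : Γ.left ≤ Γ.left ⊔ Γ.right)
        (Γ.end₁_eq.1 ((h.symm e f).1.1 (Δ.end₁_eq.2 hef)))
    · intro e f hef
      exact (le_sup_right : Γ.right ≤ Γ.left ⊔ Γ.right)
        (Γ.end₂_eq.1 ((h.symm e f).2.1 (Δ.end₂_eq.2 hef)))
  intro e f hef
  have := hs _ _ (key hef)
  exact ⟨(h.symm e f).1.2 this.1, (h.symm e f).2.2 this.2⟩

/-- A way of gluing `(V₁, E, V₂)` to `(V₁', E', V₂')`: a map `χ : V₂ → V₁'` that preserves the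
valencies, and a subset of `E × E'` that projects bijectively onto `E` and onto `E'` (that is, the
graph of a bijection `F`) and is consistent with `χ`. -/
structure Gluing (Γ : BipGraph E) (Γ' : BipGraph E') where
  χ : Γ.V₂ → Γ'.V₁
  valency_eq : ∀ v, Γ'.valency₁ (χ v) = Γ.valency₂ v
  F : E ≃ E'
  consistent : ∀ e, χ (Γ.end₂ e) = Γ'.end₁ (F e)

namespace Gluing

variable {Γ : BipGraph E} {Γ' : BipGraph E'} {Δ : BipGraph D} {Δ' : BipGraph D'}

/-- The glued graph `(V₁, F, V₂')`; the edge `(e, F e)` is denoted by `e`. -/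
def glued (G : Gluing Γ Γ') : BipGraph E where
  left := Γ.left
  right := Γ'.right.comap G.F

/-- The order of the group of those automorphisms of the glued graph that induce on `E` an
automorphism of `(V₁, E, V₂)`. -/
def autCard (G : Gluing Γ Γ') : ℕ :=
  Nat.card {a : E ≃ E // G.glued.IsIso G.glued a ∧ Γ.IsIso Γ a}

/-- Two gluings are equivalent if automorphisms of the two graphs carry one to the other.
(The map `χ` of a gluing is determined by `F`, so that it need not be mentioned.) -/
def Equivalent (G H : Gluing Γ Γ') : Prop :=
  ∃ a : E ≃ E, ∃ b : E' ≃ E', Γ.IsIso Γ a ∧ Γ'.IsIso Γ' b ∧ ∀ e, H.F (a e) = b (G.F e)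

instance setoid (Γ : BipGraph E) (Γ' : BipGraph E') : Setoid (Gluing Γ Γ') where
  r := Equivalent
  iseqv :=
    { refl := fun _ => ⟨.refl _, .refl _, .refl _, .refl _, fun _ => rfl⟩
      symm := by
        rintro G H ⟨a, b, ha, hb, h⟩
        refine ⟨a.symm, b.symm, ha.symm, hb.symm, fun e => ?_⟩
        rw [Equiv.eq_symm_apply, ← h, Equiv.apply_symm_apply]
      trans := by
        rintro G H K ⟨a, b, ha, hb, h⟩ ⟨a', b', ha', hb', h'⟩
        exact ⟨a.trans a', b.trans b', ha.trans ha', hb.trans hb', fun e => by simp [h, h']⟩ }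

theorem F_injective : Function.Injective (F : Gluing Γ Γ' → (E ≃ E')) := by
  rintro ⟨χ, _, F, h⟩ ⟨χ', _, F', h'⟩ (rfl : F = F')
  have : χ = χ' := by
    funext v
    induction v using Quotient.inductionOn with
    | h e => exact (h e).trans (h' e).symm
  subst this
  rfl

instance [Finite E] [Finite E'] : Finite (Gluing Γ Γ') := Finite.of_injective _ F_injective

theorem end_iff (G : Gluing Γ Γ') [Finite E] (e f : E) :
    Γ.end₂ e = Γ.end₂ f ↔ Γ'.end₁ (G.F e) = Γ'.end₁ (G.F f) := by
  refine ⟨fun h => by rw [← G.consistent, ← G.consistent, h], fun h => ?_⟩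
  have : Finite E' := Finite.of_equiv _ G.F
  let g : {x : E // Γ.end₂ x = Γ.end₂ e} → {y : E' // Γ'.end₁ y = G.χ (Γ.end₂ e)} :=
    fun x => ⟨G.F x.1, by rw [← G.consistent, x.2]⟩
  have hg : Function.Injective g := fun x y hxy =>
    Subtype.ext (G.F.injective (congrArg Subtype.val hxy))
  have hb : Function.Bijective g :=
    (Nat.bijective_iff_injective_and_card g).2 ⟨hg, (G.valency_eq (Γ.end₂ e)).symm⟩
  obtain ⟨x, hx⟩ := hb.2 ⟨G.F f, by rw [← h, G.consistent]⟩
  have hxf : x.1 = f := G.F.injective (congrArg Subtype.val hx)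
  rw [← hxf, x.2]

/-- The gluing given by a bijection of the edges. -/
def ofEquiv (F : E ≃ E') (h : ∀ e f, Γ.end₂ e = Γ.end₂ f ↔ Γ'.end₁ (F e) = Γ'.end₁ (F f)) :
    Gluing Γ Γ' where
  χ := Quotient.lift (fun e => Γ'.end₁ (F e)) fun e f hef => (h e f).1 (Quotient.sound hef)
  valency_eq := by
    intro v
    induction v using Quotient.inductionOn with
    | h e =>
      refine Nat.card_congr (F.subtypeEquiv fun f => ?_).symm
      exact h f e
  F := F
  consistent := fun _ => rfl

/-- Transport of a gluing along isomorphisms. -/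
def map [Finite E] {a : E ≃ D} {b : E' ≃ D'} (ha : Γ.IsIso Δ a) (hb : Γ'.IsIso Δ' b)
    (G : Gluing Γ Γ') : Gluing Δ Δ' :=
  ofEquiv ((a.symm.trans G.F).trans b) fun e f =>
    ((ha.symm e f).2.trans (G.end_iff _ _)).trans (hb _ _).1

theorem map_glued_isIso [Finite E] {a : E ≃ D} {b : E' ≃ D'} (ha : Γ.IsIso Δ a)
    (hb : Γ'.IsIso Δ' b) (G : Gluing Γ Γ') : G.glued.IsIso (G.map ha hb).glued a := by
  intro e f
  have h1 := (ha e f).1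
  have h2 := (hb (G.F e) (G.F f)).2
  simp only [end₁_eq, end₂_eq] at h1 h2
  simp [glued, map, ofEquiv, Setoid.comap_rel, h1, h2]

theorem map_autCard [Finite E] {a : E ≃ D} {b : E' ≃ D'} (ha : Γ.IsIso Δ a)
    (hb : Γ'.IsIso Δ' b) (G : Gluing Γ Γ') : (G.map ha hb).autCard = G.autCard := by
  have hg := G.map_glued_isIso ha hb
  refine Nat.card_congr
    { toFun := fun u => ⟨(a.trans u.1).trans a.symm,
        (hg.trans u.2.1).trans hg.symm, (ha.trans u.2.2).trans ha.symm⟩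
      invFun := fun u => ⟨(a.symm.trans u.1).trans a,
        (hg.symm.trans u.2.1).trans hg, (ha.symm.trans u.2.2).trans ha⟩
      left_inv := fun u => ?_
      right_inv := fun u => ?_ } <;>
  · apply Subtype.ext; ext; simp

theorem equivalent_iff_map [Finite E] {G H : Gluing Γ Γ'} :
    G ≈ H ↔ ∃ a : E ≃ E, ∃ b : E' ≃ E', ∃ ha : Γ.IsIso Γ a, ∃ hb : Γ'.IsIso Γ' b,
      H = G.map ha hb := by
  constructor
  · rintro ⟨a, b, ha, hb, h⟩
    refine ⟨a, b, ha, hb, F_injective (Equiv.ext fun e => ?_)⟩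
    simpa [map, ofEquiv] using h (a.symm e)
  · rintro ⟨a, b, ha, hb, rfl⟩
    exact ⟨a, b, ha, hb, fun e => by simp [map, ofEquiv]⟩

/-- Transport of equivalence classes of gluings along isomorphisms. -/
def mapQuotient [Finite E] [Finite D] {a : E ≃ D} {b : E' ≃ D'} (ha : Γ.IsIso Δ a)
    (hb : Γ'.IsIso Δ' b) : Quotient (setoid Γ Γ') ≃ Quotient (setoid Δ Δ') :=
  Quotient.congr
    { toFun := map ha hb
      invFun := map ha.symm hb.symm
      left_inv := fun G => F_injective (Equiv.ext fun e => by simp [map, ofEquiv])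
      right_inv := fun G => F_injective (Equiv.ext fun e => by simp [map, ofEquiv]) }
    (by
      intro G H
      constructor
      · rintro ⟨u, v, hu, hv, h⟩
        exact ⟨(a.symm.trans u).trans a, (b.symm.trans v).trans b, (ha.symm.trans hu).trans ha,
          (hb.symm.trans hv).trans hb, fun e => by simp [map, ofEquiv, h]⟩
      · rintro ⟨u, v, hu, hv, h⟩
        refine ⟨(a.trans u).trans a.symm, (b.trans v).trans b.symm, (ha.trans hu).trans ha.symm,
          (hb.trans hv).trans hb.symm, fun e => ?_⟩
        have := h (a e)
        simp only [map, ofEquiv, Equiv.coe_fn_mk, Equiv.trans_apply,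
          Equiv.symm_apply_apply] at this
        simp [← this])

end Gluing

instance isoSetoid (n : ℕ) : Setoid (BipGraph (Fin n)) where
  r Γ Δ := ∃ a, Γ.IsIso Δ a
  iseqv :=
    { refl := fun Γ => ⟨_, IsIso.refl Γ⟩
      symm := fun ⟨_, h⟩ => ⟨_, h.symm⟩
      trans := fun ⟨_, h⟩ ⟨_, h'⟩ => ⟨_, h.trans h'⟩ }

instance [Finite E] : Finite (BipGraph E) := by
  have h : Function.Injective
      (fun Γ : BipGraph E => ((fun e f => Γ.left e f, fun e f => Γ.right e f) :
        (E → E → Prop) × (E → E → Prop))) := by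
    rintro ⟨l, r⟩ ⟨l', r'⟩ h
    simp only [Prod.mk.injEq] at h
    obtain rfl : l = l' := Setoid.ext fun e f => iff_of_eq (congrFun (congrFun h.1 e) f)
    obtain rfl : r = r' := Setoid.ext fun e f => iff_of_eq (congrFun (congrFun h.2 e) f)
    rfl
  exact Finite.of_injective _ h

end BipGraph

open BipGraph

/-- The set of isomorphism classes of bipartite graphs of degree `n`, i.e. with `n` edges. -/
def BipClass (n : ℕ) : Type := Quotient (BipGraph.isoSetoid n)

instance (n : ℕ) : Finite (BipClass n) := inferInstanceAs (Finite (Quotient _))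

instance (n : ℕ) : Fintype (BipClass n) := Fintype.ofFinite _

/-- The isomorphism class of a bipartite graph with edge set `Fin n`. -/
def BipClass.mk {n : ℕ} (Γ : BipGraph (Fin n)) : BipClass n := Quotient.mk _ Γ

/-- The vector space with basis the isomorphism classes of bipartite graphs of degree `n`. -/
abbrev B (n : ℕ) : Type := BipClass n →₀ ℂ

/-- The contribution `(|Aut (V₁, F, V₂')| / |Aut_F (V₁, F, V₂')|) [(V₁, F, V₂')]` of a gluing. -/
def gluingTerm {n : ℕ} {Γ Γ' : BipGraph (Fin n)} (G : Gluing Γ Γ') : B n :=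
  Finsupp.single (BipClass.mk G.glued) ((G.glued.autCard : ℂ) / (G.autCard : ℂ))

theorem gluingTerm_map {n : ℕ} {Γ Γ' Δ Δ' : BipGraph (Fin n)} {a b : Fin n ≃ Fin n}
    (ha : Γ.IsIso Δ a) (hb : Γ'.IsIso Δ' b) (G : Gluing Γ Γ') :
    gluingTerm (G.map ha hb) = gluingTerm G := by
  have hg := G.map_glued_isIso ha hb
  rw [gluingTerm, gluingTerm, G.map_autCard ha hb, ← autCard_congr hg,
    show BipClass.mk (G.map ha hb).glued = BipClass.mk G.glued from
      (Quotient.sound ⟨a, hg⟩ : BipClass.mk G.glued = _).symm]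

/-- The contribution of an equivalence class of gluings. -/
def gluingClassTerm {n : ℕ} {Γ Γ' : BipGraph (Fin n)} :
    Quotient (Gluing.setoid Γ Γ') → B n :=
  Quotient.lift gluingTerm (by
    intro G H h
    obtain ⟨a, b, ha, hb, rfl⟩ := Gluing.equivalent_iff_map.1 h
    exact (gluingTerm_map ha hb G).symm)

instance {n : ℕ} (Γ Γ' : BipGraph (Fin n)) : Fintype (Quotient (Gluing.setoid Γ Γ')) :=
  Fintype.ofFinite _

/-- The product of two graphs of degree `n`: the sum over all gluings, up to equivalence. -/
def graphMul {n : ℕ} (Γ Γ' : BipGraph (Fin n)) : B n :=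
  ∑ q : Quotient (Gluing.setoid Γ Γ'), gluingClassTerm q

theorem graphMul_congr {n : ℕ} {Γ Γ' Δ Δ' : BipGraph (Fin n)} {a b : Fin n ≃ Fin n}
    (ha : Γ.IsIso Δ a) (hb : Γ'.IsIso Δ' b) : graphMul Γ Γ' = graphMul Δ Δ' := by
  refine Fintype.sum_equiv (Gluing.mapQuotient ha hb) _ _ fun q => ?_
  induction q using Quotient.inductionOn with
  | h G => exact (gluingTerm_map ha hb G).symm

/-- The product of two isomorphism classes of graphs of degree `n`. -/
def classMul {n : ℕ} : BipClass n → BipClass n → B n :=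
  Quotient.lift₂ graphMul fun _ _ _ _ ⟨_, ha⟩ ⟨_, hb⟩ => graphMul_congr ha hb

/-- The bilinear product `*` on `B n`. -/
def mul (n : ℕ) : B n →ₗ[ℂ] B n →ₗ[ℂ] B n :=
  Finsupp.lift _ ℂ _ fun Γ => Finsupp.lift _ ℂ _ fun Γ' => classMul Γ Γ'

/-- The order of the automorphism group of (any representative of) a class. -/
def BipClass.autCard {n : ℕ} : BipClass n → ℕ :=
  Quotient.lift BipGraph.autCard fun _ _ ⟨_, h⟩ => autCard_congr h

/-- The class consists of simple graphs. -/
def BipClass.IsSimple {n : ℕ} : BipClass n → Prop :=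
  Quotient.lift BipGraph.IsSimple fun _ _ ⟨_, h⟩ =>
    propext ⟨fun hs => hs.of_iso h, fun hs => hs.of_iso h.symm⟩

/-- The bijection of the edge sets that numbers the edges of a disjoint union. -/
def sumEquiv {m n : ℕ} (h : m ≤ n) : Fin m ⊕ Fin (n - m) ≃ Fin n :=
  finSumFinEquiv.trans (finCongr (Nat.add_sub_of_le h))

/-- The class of the disjoint union of a graph of degree `m` and a graph of degree `n - m`. -/
def BipClass.extend {m n : ℕ} (h : m ≤ n) : BipClass m → BipClass (n - m) → BipClass n :=
  Quotient.lift₂ (fun Γ S => BipClass.mk ((Γ.disjUnion S).relabel (sumEquiv h)))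
    fun _ _ _ _ ⟨_, ha⟩ ⟨_, hb⟩ => Quotient.sound ⟨_, ((relabel_isIso _ _).symm.trans
      (disjUnion_isIso ha hb)).trans (relabel_isIso _ _)⟩

open Classical in
/-- The sum of `|Aut Γ̃| / (|Aut Γ| |Aut (Γ̃ \ Γ)|) Γ̃` over the standard extensions `Γ̃` of degree
`n` of a graph `Γ` of degree `m ≤ n`: the disjoint unions of `Γ` and a simple graph `S = Γ̃ \ Γ` of
degree `n - m`. -/
def classRho {m n : ℕ} (h : m ≤ n) (Γ : BipClass m) : B n :=
  ∑ S : BipClass (n - m) with S.IsSimple,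
    Finsupp.single (Γ.extend h S)
      (((Γ.extend h S).autCard : ℂ) / ((Γ.autCard : ℂ) * (S.autCard : ℂ)))

/-- The linear map `ρₙ : B m → B n` for `m ≤ n` (it is not used for `n < m`, where it is set to
zero). -/
def rho (m n : ℕ) : B m →ₗ[ℂ] B n :=
  if h : m ≤ n then Finsupp.lift _ ℂ _ (classRho h) else 0

/-- The product `Γ₁ *ₙ Γ₂ = ρₙ(Γ₁) * ρₙ(Γ₂)` for graphs of degrees not greater than `n`. -/
def starMul {m₁ m₂ : ℕ} (Γ₁ : BipClass m₁) (Γ₂ : BipClass m₂) (n : ℕ) : B n :=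
  mul n (rho m₁ n (Finsupp.single Γ₁ 1)) (rho m₂ n (Finsupp.single Γ₂ 1))

/-- The components `{Γ₁ Γ₂}ₙ`, defined recursively for `n ≥ max |Γ₁| |Γ₂|` (and set to zero
below, where they are not used). -/
def bracket {m₁ m₂ : ℕ} (Γ₁ : BipClass m₁) (Γ₂ : BipClass m₂) (n : ℕ) : B n :=
  if n < max m₁ m₂ then 0
  else starMul Γ₁ Γ₂ n -
    ∑ k ∈ (Ico (max m₁ m₂) n).attach, rho k.1 n (bracket Γ₁ Γ₂ k.1)
termination_by n
decreasing_by exact (Finset.mem_Ico.1 k.2).2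

/-- The vector space with basis the isomorphism classes of all bipartite graphs. -/
abbrev BInf : Type := (Σ n, BipClass n) →₀ ℂ

/-- The inclusion of `B n` into `BInf`. -/
def incl (n : ℕ) : B n →ₗ[ℂ] BInf := Finsupp.lmapDomain ℂ ℂ (Sigma.mk n)

/-- The product `Γ₁ ∘ Γ₂`, the sum of `{Γ₁ Γ₂}ₙ` over all `n ≥ max |Γ₁| |Γ₂|`. -/
def classCirc {m₁ m₂ : ℕ} (Γ₁ : BipClass m₁) (Γ₂ : BipClass m₂) : BInf :=
  ∑ᶠ (n : ℕ) (_ : max m₁ m₂ ≤ n), incl n (bracket Γ₁ Γ₂ n)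

/-- The bilinear product `∘` on `BInf`. -/
def circ : BInf →ₗ[ℂ] BInf →ₗ[ℂ] BInf :=
  Finsupp.lift _ ℂ _ fun Γ₁ => Finsupp.lift _ ℂ _ fun Γ₂ => classCirc Γ₁.2 Γ₂.2

end BipartiteGraphs

end

/-!
A graph with edge set `E` is a pair `(p, q)` of partitions of `E`, so an element of `B n` is a
matrix indexed by the partitions of `n` edges. Up to automorphisms a gluing of `(p, q)` to a
second graph identifies their edge sets so that the second graph becomes some `(q, r)`; by
orbit-stabilizer the factors in the definition of `*` are exactly those that turn `*` into the
matrix product.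

In the same way, the coefficient of `(p, q)` in `ρₙ(x)` is the sum of the coefficients in `x` of
the subgraphs `(p, q)|_Z`, over the edge sets `Z` off which `p` and `q` agree. In the product of
two such extended matrices a term is given by `q`, by `X` off which `p` and `q` agree, and by `Y`
off which `q` and `r` agree. Collecting the terms with a given union `Z = X ∪ Y`, off which `q` is
determined by `p`, shows that this product is again an extended matrix, namely of an overlap
product which only involves triples with `X ∪ Y` the whole edge set. Extension is unitriangular
with respect to the degree, so `{Γ₁Γ₂}ₙ` is the part of degree `n` of the overlap product of `Γ₁`
and `Γ₂`. It vanishes for `n > |Γ₁| + |Γ₂|` since `|X ∪ Y| ≤ |X| + |Y|`, and associativity is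
inherited from matrices.
-/

noncomputable section

namespace BipartiteGraphs

open BipGraph

section Partitions

variable {E D : Type*} {p q r s : Setoid E} {X Y Z : Set E}

instance [Finite E] : Finite (Setoid E) :=
  Finite.of_injective (fun s : Setoid E => (s : E → E → Prop)) fun _ _ h =>
    Setoid.ext fun e f => iff_of_eq (congrFun (congrFun h e) f)

instance [Finite E] : Fintype (Setoid E) := Fintype.ofFinite _

/-- The set `Z` is a union of classes of the partition `s`. -/
def Saturated (s : Setoid E) (Z : Set E) : Prop := ∀ ⦃e f⦄, s e f → (e ∈ Z ↔ f ∈ Z)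

/-- The partitions `p` and `q` agree off `Z`: the set `Z` is a union of classes of each of them
(for `q` see `AgreeOff.saturated_right`), and they have the same classes outside `Z`. For a graph
with sides `p` and `q` this means that it is the disjoint union of its edges in `Z` and of a simple
graph. -/
structure AgreeOff (Z : Set E) (p q : Setoid E) : Prop where
  saturated : Saturated p Z
  rel_iff : ∀ ⦃e⦄, e ∉ Z → ∀ f, p e f ↔ q e f

instance : Decidable (Saturated s Z) := Classical.dec _

instance : Decidable (AgreeOff Z p q) := Classical.dec _

theorem Saturated.union (hX : Saturated s X) (hY : Saturated s Y) : Saturated s (X ∪ Y) :=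
  fun _ _ h => or_congr (hX h) (hY h)

theorem agreeOff_univ (p q : Setoid E) : AgreeOff Set.univ p q :=
  ⟨fun _ _ _ => Iff.rfl, fun _ h => absurd trivial h⟩

namespace AgreeOff

theorem saturated_right (h : AgreeOff Z p q) : Saturated q Z := by
  have mem_of_rel : ∀ ⦃e f⦄, q e f → e ∈ Z → f ∈ Z := fun e f hef he => by
    by_contra hf
    exact hf ((h.saturated ((h.rel_iff hf e).2 (q.symm hef))).2 he)
  exact fun e f hef => ⟨mem_of_rel hef, mem_of_rel (q.symm hef)⟩

theorem symm (h : AgreeOff Z p q) : AgreeOff Z q p :=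
  ⟨h.saturated_right, fun _ he f => (h.rel_iff he f).symm⟩

theorem trans (h : AgreeOff Z p q) (h' : AgreeOff Z q r) : AgreeOff Z p r :=
  ⟨h.saturated, fun _ he f => (h.rel_iff he f).trans (h'.rel_iff he f)⟩

theorem mono (h : AgreeOff X p q) (hXZ : X ⊆ Z) (hZ : Saturated q Z) : AgreeOff Z p q where
  saturated e f hef := by
    by_cases he : e ∈ X
    · exact iff_of_true (hXZ he) (hXZ ((h.saturated hef).1 he))
    · exact hZ ((h.rel_iff he f).1 hef)
  rel_iff _ he f := h.rel_iff (fun heX => he (hXZ heX)) f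

theorem union_left (h : AgreeOff X p q) (h' : AgreeOff Y q r) : AgreeOff (X ∪ Y) p q :=
  h.mono Set.subset_union_left (h.saturated_right.union h'.saturated)

theorem union (h : AgreeOff X p q) (h' : AgreeOff Y q r) : AgreeOff (X ∪ Y) p r :=
  (h.union_left h').trans (Set.union_comm X Y ▸ h'.symm.union_left h.symm).symm

theorem comap (h : AgreeOff Z p q) (i : D → E) :
    AgreeOff (i ⁻¹' Z) (p.comap i) (q.comap i) :=
  ⟨fun _ _ hef => h.saturated hef, fun _ he f => h.rel_iff he (i f)⟩

theorem of_comap {i : D → E} (h : AgreeOff (Set.range i) p q) (hX : X ⊆ Set.range i)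
    (hXi : AgreeOff (i ⁻¹' X) (p.comap i) (q.comap i)) : AgreeOff X p q := by
  have not_mem : ∀ ⦃e f⦄, e ∉ Set.range i → p e f → f ∉ X := fun e f he hef hf =>
    he ((h.saturated hef).2 (hX hf))
  constructor
  · intro e f hef
    by_cases he : e ∈ Set.range i
    · obtain ⟨⟨x, rfl⟩, ⟨y, rfl⟩⟩ := And.intro he ((h.saturated hef).1 he)
      exact hXi.saturated hef
    · exact iff_of_false (fun heX => he (hX heX)) (not_mem he hef)
  · intro e he f
    by_cases her : e ∈ Set.range i
    · by_cases hfr : f ∈ Set.range i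
      · obtain ⟨⟨x, rfl⟩, ⟨y, rfl⟩⟩ := And.intro her hfr
        exact hXi.rel_iff he y
      · exact iff_of_false (fun hef => hfr ((h.saturated hef).1 her))
          fun hef => hfr ((h.saturated_right hef).1 her)
    · exact h.rel_iff her f

theorem eq_of_comap_eq {i : D → E} (h : AgreeOff (Set.range i) p q)
    (h' : AgreeOff (Set.range i) p r) (hi : q.comap i = r.comap i) : q = r := by
  ext e f
  by_cases he : e ∈ Set.range i
  · by_cases hf : f ∈ Set.range i
    · obtain ⟨⟨x, rfl⟩, ⟨y, rfl⟩⟩ := And.intro he hf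
      exact Setoid.ext_iff.1 hi x y
    · exact iff_of_false (fun hef => hf ((h.saturated_right hef).1 he))
        fun hef => hf ((h'.saturated_right hef).1 he)
  · exact ((h.rel_iff he f).symm.trans (h'.rel_iff he f))

end AgreeOff

/-- The partition of `E` that is `q`, transported along the injection `i`, on the range of `i`,
and is `p` on the complement. -/
def extendSetoid (p : Setoid E) (i : D → E) (q : Setoid D) : Setoid E :=
  Setoid.ker (Function.extend i (Sum.inl ∘ Quotient.mk q) (Sum.inr ∘ Quotient.mk p))

theorem extendSetoid_comap {i : D → E} (hi : Function.Injective i) (p : Setoid E)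
    (q : Setoid D) : (extendSetoid p i q).comap i = q := by
  ext e f
  rw [Setoid.comap_rel, extendSetoid, Setoid.ker_def, hi.extend_apply, hi.extend_apply,
    Function.comp_apply, Function.comp_apply, Sum.inl.injEq, Quotient.eq]

theorem agreeOff_extendSetoid {i : D → E} (hi : Function.Injective i)
    (hp : Saturated p (Set.range i)) (q : Setoid D) :
    AgreeOff (Set.range i) p (extendSetoid p i q) := by
  refine ⟨hp, fun e he f => ?_⟩
  rw [extendSetoid, Setoid.ker_def, Function.extend_apply' _ _ _ he]
  by_cases hf : f ∈ Set.range i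
  · obtain ⟨y, rfl⟩ := hf
    rw [hi.extend_apply]
    exact iff_of_false (fun hef => he ((hp hef).2 ⟨y, rfl⟩)) Sum.inr_ne_inl
  · rw [Function.extend_apply' _ _ _ hf]
    simp only [Function.comp_apply, Sum.inr.injEq, Quotient.eq]

end Partitions

section Classes

namespace BipGraph

variable {E D : Type}

/-- The pull-back of a bipartite graph along a map into its edge set. -/
def comap (Γ : BipGraph E) (i : D → E) : BipGraph D := ⟨Γ.left.comap i, Γ.right.comap i⟩

/-- The subgraph with edge set `Z`. -/
def induce (Γ : BipGraph E) (Z : Set E) : BipGraph Z := Γ.comap Subtype.val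

theorem comap_left (Γ : BipGraph E) (i : D → E) : (Γ.comap i).left = Γ.left.comap i := rfl

theorem comap_right (Γ : BipGraph E) (i : D → E) : (Γ.comap i).right = Γ.right.comap i := rfl

theorem eq_iff_left_right {Γ Δ : BipGraph E} : Γ = Δ ↔ Γ.left = Δ.left ∧ Γ.right = Δ.right := by
  cases Γ; cases Δ; simp only [mk.injEq]

theorem isIso_iff {Γ : BipGraph E} {Δ : BipGraph D} {a : E ≃ D} :
    Γ.IsIso Δ a ↔ Γ = Δ.comap a := by
  simp only [IsIso, end₁_eq, end₂_eq, eq_iff_left_right, Setoid.ext_iff, comap_left, comap_right,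
    Setoid.comap_rel, forall_and]

theorem comap_isIso (Δ : BipGraph D) (a : E ≃ D) : (Δ.comap a).IsIso Δ a := isIso_iff.2 rfl

end BipGraph

/-- The set of isomorphism classes of bipartite graphs of all degrees. -/
abbrev IsoClass : Type := Σ n, BipClass n

theorem BipClass.mk_surjective {n : ℕ} : Function.Surjective (BipClass.mk (n := n)) :=
  Quotient.mk_surjective

theorem sigma_mk_eq_iff {m n : ℕ} {Γ : BipGraph (Fin m)} {Δ : BipGraph (Fin n)} :
    (⟨m, BipClass.mk Γ⟩ : IsoClass) = ⟨n, BipClass.mk Δ⟩ ↔ ∃ a, Γ.IsIso Δ a := by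
  constructor
  · intro h
    obtain rfl : m = n := congrArg Sigma.fst h
    exact Quotient.exact (sigma_mk_injective (β := BipClass) h)
  · rintro ⟨a, ha⟩
    obtain rfl : m = n := Fin.equiv_iff_eq.1 ⟨a⟩
    exact congrArg (Sigma.mk m) (Quotient.sound ⟨a, ha⟩)

namespace BipGraph

variable {E D : Type}

/-- The isomorphism class of a bipartite graph with an arbitrary finite edge set. -/
def cls [Finite E] (Γ : BipGraph E) : IsoClass :=
  ⟨Nat.card E, BipClass.mk (Γ.relabel (Finite.equivFin E))⟩

theorem cls_eq_iff [Finite E] [Finite D] {Γ : BipGraph E} {Δ : BipGraph D} :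
    cls Γ = cls Δ ↔ ∃ a, Γ.IsIso Δ a := by
  refine sigma_mk_eq_iff.trans ⟨fun ⟨a, ha⟩ => ?_, fun ⟨a, ha⟩ => ?_⟩
  · exact ⟨_, ((relabel_isIso _ _).trans ha).trans (relabel_isIso _ _).symm⟩
  · exact ⟨_, ((relabel_isIso _ _).symm.trans ha).trans (relabel_isIso _ _)⟩

theorem cls_mk {n : ℕ} (Γ : BipGraph (Fin n)) : cls Γ = ⟨n, BipClass.mk Γ⟩ :=
  sigma_mk_eq_iff.2 ⟨_, (relabel_isIso _ _).symm⟩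

theorem cls_comap [Finite E] [Finite D] (Γ : BipGraph E) (a : D ≃ E) :
    cls (Γ.comap a) = cls Γ :=
  cls_eq_iff.2 ⟨a, comap_isIso Γ a⟩

theorem cls_induce_comap [Finite E] [Finite D] (Γ : BipGraph E) {i : D → E}
    (hi : Function.Injective i) {X : Set E} (hX : X ⊆ Set.range i) :
    cls ((Γ.comap i).induce (i ⁻¹' X)) = cls (Γ.induce X) :=
  cls_comap (Γ.induce X) (Equiv.ofBijective (Set.restrictPreimage X i)
    ⟨hi.restrictPreimage X, fun ⟨e, he⟩ => by
      obtain ⟨d, rfl⟩ := hX he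
      exact ⟨⟨d, he⟩, rfl⟩⟩)

theorem cls_induce_univ [Finite E] (Γ : BipGraph E) : cls (Γ.induce Set.univ) = cls Γ :=
  cls_comap Γ (Equiv.Set.univ E)

/-- The number of isomorphisms between two bipartite graphs. -/
def isoCount (Γ : BipGraph E) (Δ : BipGraph D) : ℕ := Nat.card {a : E ≃ D // Γ.IsIso Δ a}

open Classical in
theorem isoCount_eq [Finite E] [Finite D] (Γ : BipGraph E) (Δ : BipGraph D) :
    isoCount Γ Δ = if cls Γ = cls Δ then Γ.autCard else 0 := by
  split_ifs with h
  · obtain ⟨c, hc⟩ := cls_eq_iff.1 h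
    refine Nat.card_congr (((Equiv.refl E).equivCongr c.symm).subtypeEquiv fun a => ?_)
    exact ⟨fun ha => ha.trans hc.symm, fun ha => by
      simpa [IsIso, Equiv.equivCongr] using IsIso.trans ha hc⟩
  · have : IsEmpty {a : E ≃ D // Γ.IsIso Δ a} := ⟨fun a => h (cls_eq_iff.2 ⟨a.1, a.2⟩)⟩
    exact Nat.card_of_isEmpty

theorem autCard_pos [Finite E] (Γ : BipGraph E) : 0 < Γ.autCard :=
  have : Nonempty {a : E ≃ E // Γ.IsIso Γ a} := ⟨⟨_, IsIso.refl Γ⟩⟩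
  Nat.card_pos

theorem single_cls_apply [Finite E] [Finite D] (Γ : BipGraph E) (Δ : BipGraph D) (z : ℂ) :
    Finsupp.single (cls Γ) z (cls Δ) = z / Γ.autCard * isoCount Γ Δ := by
  classical
  have hΓ : (Γ.autCard : ℂ) ≠ 0 := mod_cast Γ.autCard_pos.ne'
  rw [Finsupp.single_apply, isoCount_eq]
  split_ifs with h
  · rw [div_mul_cancel₀ _ hΓ]
  · rw [Nat.cast_zero, mul_zero]

theorem single_mk_apply {n : ℕ} (c : BipClass n) (z : ℂ) (Δ : BipGraph (Fin n)) :
    Finsupp.single c z (BipClass.mk Δ) = Finsupp.single (⟨n, c⟩ : IsoClass) z (cls Δ) := by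
  rw [cls_mk, Finsupp.single_apply_left sigma_mk_injective]

end BipGraph

end Classes

section MatrixProduct

namespace BipGraph

variable {E E' D : Type}

/-- The automorphism group of a bipartite graph, as a group of permutations of the edges. -/
def aut (Γ : BipGraph E) : Subgroup (Equiv.Perm E) where
  carrier := {a | Γ.IsIso Γ a}
  mul_mem' ha hb := IsIso.trans hb ha
  one_mem' := IsIso.refl Γ
  inv_mem' h := IsIso.symm h

namespace Gluing

variable {Γ : BipGraph E} {Γ' : BipGraph E'}

instance [Finite E] [Finite E'] : Fintype (Gluing Γ Γ') := Fintype.ofFinite _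

theorem right_eq_comap [Finite E] (G : Gluing Γ Γ') : Γ.right = Γ'.left.comap G.F := by
  ext e f
  simpa only [end₁_eq, end₂_eq, Setoid.comap_rel] using G.end_iff e f

instance [Finite E] : MulAction (aut Γ × aut Γ') (Gluing Γ Γ') where
  smul g G := G.map g.1.2 g.2.2
  one_smul _ := F_injective rfl
  mul_smul _ _ _ := F_injective rfl

theorem smul_eq_self_iff [Finite E] (g : aut Γ × aut Γ') (G : Gluing Γ Γ') :
    g • G = G ↔ G.F.permCongr g.1 = (g.2 : Equiv.Perm E') := by
  rw [← F_injective.eq_iff]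
  change (((g.1 : Equiv.Perm E).symm.trans G.F).trans (g.2 : Equiv.Perm E')) = G.F ↔ _
  simp only [Equiv.ext_iff, Equiv.trans_apply, Equiv.permCongr_apply]
  exact ⟨fun h y => by simpa using (h ((g.1 : Equiv.Perm E) (G.F.symm y))).symm,
    fun h x => by simpa using (h (G.F ((g.1 : Equiv.Perm E).symm x))).symm⟩

theorem permCongr_isIso_iff [Finite E] (G : Gluing Γ Γ') {a : Equiv.Perm E}
    (ha : Γ.IsIso Γ a) : Γ'.IsIso Γ' (G.F.permCongr a) ↔ G.glued.IsIso G.glued a := by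
  have conj_iff : Γ'.IsIso Γ' (G.F.permCongr a) ↔ (Γ'.comap G.F).IsIso (Γ'.comap G.F) a := by
    constructor <;> intro h e f
    · simpa [comap, Setoid.comap_rel] using h (G.F e) (G.F f)
    · simpa [comap, Setoid.comap_rel] using h (G.F.symm e) (G.F.symm f)
  have ha' := eq_iff_left_right.1 (isIso_iff.1 ha)
  rw [conj_iff, isIso_iff, isIso_iff, eq_iff_left_right, eq_iff_left_right]
  simp only [comap_left, comap_right] at ha' ⊢
  rw [← G.right_eq_comap]
  exact (and_iff_right ha'.2).trans (and_iff_right ha'.1).symm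

theorem card_stabilizer [Finite E] (G : Gluing Γ Γ') :
    Nat.card (MulAction.stabilizer (aut Γ × aut Γ') G) = G.autCard :=
  Nat.card_congr
    { toFun := fun g => ⟨g.1.1, (G.permCongr_isIso_iff g.1.1.2).1
        ((smul_eq_self_iff g.1 G).1 g.2 ▸ g.1.2.2), g.1.1.2⟩
      invFun := fun a => ⟨(⟨a.1, a.2.2⟩,
        ⟨G.F.permCongr a.1, (G.permCongr_isIso_iff a.2.2).2 a.2.1⟩),
        (smul_eq_self_iff _ G).2 rfl⟩
      left_inv := fun g =>
        Subtype.ext (Prod.ext rfl (Subtype.ext ((smul_eq_self_iff g.1 G).1 g.2)))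
      right_inv := fun _ => rfl }

theorem equiv_iff_mem_orbit [Finite E] (G H : Gluing Γ Γ') :
    H ≈ G ↔ H ∈ MulAction.orbit (aut Γ × aut Γ') G := by
  rw [Setoid.comm, equivalent_iff_map]
  exact ⟨fun ⟨a, b, ha, hb, h⟩ => ⟨(⟨a, ha⟩, ⟨b, hb⟩), h.symm⟩,
    fun ⟨g, h⟩ => ⟨g.1, g.2, g.1.2, g.2.2, h.symm⟩⟩

theorem card_class_mul_autCard [Finite E] (G : Gluing Γ Γ') :
    Nat.card {H : Gluing Γ Γ' // H ≈ G} * G.autCard = Γ.autCard * Γ'.autCard := by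
  rw [← card_stabilizer, Nat.card_congr (Equiv.subtypeEquivRight (equiv_iff_mem_orbit G)),
    ← Nat.card_prod, Nat.card_congr (MulAction.orbitProdStabilizerEquivGroup _ G), Nat.card_prod]
  rfl

theorem autCard_pos [Finite E] (G : Gluing Γ Γ') : 0 < G.autCard :=
  have : Nonempty {a : E ≃ E // G.glued.IsIso G.glued a ∧ Γ.IsIso Γ a} :=
    ⟨⟨_, IsIso.refl _, IsIso.refl _⟩⟩
  Nat.card_pos

/-- Triples of a partition `q` and isomorphisms `Γ → (p, q)`, `Γ' → (q, r)` correspond to gluings of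
`Γ` and `Γ'` together with an isomorphism of the glued graph with `(p, r)`. -/
def isoPairEquiv [Finite E] (Γ : BipGraph E) (Γ' : BipGraph E') (p r : Setoid D) :
    (Σ q : Setoid D, {a : E ≃ D // Γ.IsIso ⟨p, q⟩ a} × {b : E' ≃ D // Γ'.IsIso ⟨q, r⟩ b}) ≃
      Σ G : Gluing Γ Γ', {a : E ≃ D // G.glued.IsIso ⟨p, r⟩ a} where
  toFun u := ⟨ofEquiv (u.2.1.1.trans u.2.2.1.symm) fun e f =>
      (u.2.1.2 e f).2.trans (u.2.2.2.symm _ _).1, u.2.1.1, fun e f =>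
      ⟨(u.2.1.2 e f).1, by
        simpa [ofEquiv, glued, Setoid.comap_rel] using
          (u.2.2.2.symm (u.2.1.1 e) (u.2.1.1 f)).2.symm⟩⟩
  invFun v := ⟨Γ.right.comap v.2.1.symm,
    ⟨v.2.1, fun e f => ⟨(v.2.2 e f).1, by simp [Setoid.comap_rel]⟩⟩,
    ⟨v.1.F.symm.trans v.2.1, fun e f => ⟨by
      simpa [Setoid.comap_rel] using (v.1.end_iff (v.1.F.symm e) (v.1.F.symm f)).symm, by
      simpa [glued, Setoid.comap_rel] using (v.2.2 (v.1.F.symm e) (v.1.F.symm f)).2⟩⟩⟩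
  left_inv := by
    rintro ⟨q, ⟨a, ha⟩, b, hb⟩
    obtain rfl : q = Γ.right.comap a.symm := (eq_iff_left_right.1 (isIso_iff.1 ha.symm)).2
    refine Sigma.ext rfl (heq_of_eq (Prod.ext rfl (Subtype.ext (Equiv.ext fun e => ?_))))
    simp [ofEquiv]
  right_inv := by
    rintro ⟨G, a, ha⟩
    refine Sigma.subtype_ext (F_injective (Equiv.ext fun e => ?_)) rfl
    simp [ofEquiv]

theorem sum_isoCount_mul_isoCount [Finite E] [Finite E'] [Finite D] (Γ : BipGraph E)
    (Γ' : BipGraph E') (p r : Setoid D) :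
    ∑ q : Setoid D, isoCount Γ ⟨p, q⟩ * isoCount Γ' ⟨q, r⟩ =
      ∑ G : Gluing Γ Γ', isoCount G.glued ⟨p, r⟩ := by
  simpa only [isoCount, Nat.card_sigma, Nat.card_prod] using Nat.card_congr (isoPairEquiv Γ Γ' p r)

end Gluing

end BipGraph

section

variable {n : ℕ} {Γ Γ' : BipGraph (Fin n)}

theorem autCard_smul_gluingTerm (G : Gluing Γ Γ') :
    (G.autCard : ℂ) • gluingTerm G =
      Finsupp.single (BipClass.mk G.glued) (G.glued.autCard : ℂ) := by
  have hG : (G.autCard : ℂ) ≠ 0 := mod_cast G.autCard_pos.ne'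
  rw [gluingTerm, Finsupp.smul_single, smul_eq_mul, mul_div_cancel₀ _ hG]

open Classical in
theorem sum_class_single_glued (G : Gluing Γ Γ') :
    ∑ H : Gluing Γ Γ' with H ≈ G,
        Finsupp.single (BipClass.mk H.glued) (H.glued.autCard : ℂ) =
      ((Γ.autCard * Γ'.autCard : ℕ) : ℂ) • gluingTerm G := by
  have term_eq : ∀ H ∈ ({H | H ≈ G} : Finset (Gluing Γ Γ')),
      Finsupp.single (BipClass.mk H.glued) (H.glued.autCard : ℂ) =
        (G.autCard : ℂ) • gluingTerm G := by
    intro H hH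
    obtain ⟨a, b, ha, hb, rfl⟩ :=
      Gluing.equivalent_iff_map.1 (Setoid.symm (Finset.mem_filter.1 hH).2)
    rw [← autCard_smul_gluingTerm, G.map_autCard, gluingTerm_map]
  rw [Finset.sum_congr rfl term_eq, Finset.sum_const, ← Fintype.card_subtype,
    ← Nat.card_eq_fintype_card, ← Nat.cast_smul_eq_nsmul ℂ, smul_smul, ← Nat.cast_mul,
    G.card_class_mul_autCard]

theorem autCard_smul_graphMul (Γ Γ' : BipGraph (Fin n)) :
    ((Γ.autCard * Γ'.autCard : ℕ) : ℂ) • graphMul Γ Γ' =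
      ∑ G : Gluing Γ Γ', Finsupp.single (BipClass.mk G.glued) (G.glued.autCard : ℂ) := by
  classical
  rw [graphMul, Finset.smul_sum, ← Finset.sum_fiberwise _ (Quotient.mk (Gluing.setoid Γ Γ'))]
  refine Finset.sum_congr rfl fun q _ => ?_
  induction q using Quotient.inductionOn with
  | h G => simp only [Quotient.eq, gluingClassTerm, Quotient.lift_mk, ← sum_class_single_glued]

theorem graphMul_apply (Γ Γ' : BipGraph (Fin n)) (p r : Setoid (Fin n)) :
    graphMul Γ Γ' (BipClass.mk ⟨p, r⟩) = ∑ q : Setoid (Fin n),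
      Finsupp.single (BipClass.mk Γ) (1 : ℂ) (BipClass.mk ⟨p, q⟩) *
        Finsupp.single (BipClass.mk Γ') (1 : ℂ) (BipClass.mk ⟨q, r⟩) := by
  have hΓ : ∀ Γ : BipGraph (Fin n), (Γ.autCard : ℂ) ≠ 0 := fun Γ => mod_cast Γ.autCard_pos.ne'
  refine mul_left_cancel₀ (mul_ne_zero (hΓ Γ) (hΓ Γ')) ?_
  calc (Γ.autCard * Γ'.autCard : ℂ) * graphMul Γ Γ' (BipClass.mk ⟨p, r⟩)
      = ∑ G : Gluing Γ Γ', (isoCount G.glued ⟨p, r⟩ : ℂ) := by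
        rw [← Nat.cast_mul, ← smul_eq_mul, ← Finsupp.smul_apply, autCard_smul_graphMul,
          Finsupp.finsetSum_apply]
        exact Finset.sum_congr rfl fun G _ => by
          rw [single_mk_apply, ← cls_mk, single_cls_apply, div_self (hΓ _), one_mul]
    _ = ∑ q : Setoid (Fin n), (isoCount Γ ⟨p, q⟩ * isoCount Γ' ⟨q, r⟩ : ℂ) := by
        exact_mod_cast (Gluing.sum_isoCount_mul_isoCount Γ Γ' p r).symm
    _ = _ := by
        rw [Finset.mul_sum]
        refine Finset.sum_congr rfl fun q _ => ?_
        simp only [single_mk_apply, ← cls_mk, single_cls_apply]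
        field_simp [hΓ]

end

/-- The matrix of an element of `B n`: its entry at `(p, q)` is the coefficient of the class of the
graph with sides `p` and `q`. -/
def toMatrix (n : ℕ) : B n →ₗ[ℂ] Matrix (Setoid (Fin n)) (Setoid (Fin n)) ℂ where
  toFun x := Matrix.of fun p q => x (BipClass.mk ⟨p, q⟩)
  map_add' _ _ := rfl
  map_smul' _ _ := rfl

theorem toMatrix_apply {n : ℕ} (x : B n) (p q : Setoid (Fin n)) :
    toMatrix n x p q = x (BipClass.mk ⟨p, q⟩) := rfl

theorem toMatrix_mul {n : ℕ} (x y : B n) :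
    toMatrix n (mul n x y) = toMatrix n x * toMatrix n y := by
  suffices (mul n).compr₂ (toMatrix n) =
      (LinearMap.mul ℂ (Matrix _ _ ℂ)).compl₁₂ (toMatrix n) (toMatrix n) from
    LinearMap.congr_fun₂ this x y
  ext c d p r
  obtain ⟨Γ, rfl⟩ := BipClass.mk_surjective c
  obtain ⟨Γ', rfl⟩ := BipClass.mk_surjective d
  simp only [mul, LinearMap.coe_comp, Function.comp_apply, Finsupp.lsingle_apply,
    LinearMap.compr₂_apply, Finsupp.lift_apply, zero_smul, Finsupp.sum_single_index, one_smul,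
    toMatrix_apply, LinearMap.compl₁₂_apply, LinearMap.mul_apply_apply, Matrix.mul_apply]
  exact graphMul_apply Γ Γ' p r

end MatrixProduct

section Extension

variable {R : Type*} [Semiring R] {E D : Type} [Fintype E]

/-- The extension of a function of isomorphism classes to graphs with edge set `E`, as a matrix: its
entry at `(p, q)` is the sum of the values at the subgraphs of `(p, q)` that have a simple
complement. On linear combinations of graphs this is the matrix of the sum of the maps `ρₙ`, see
`toMatrix_rho`. -/
def extMatrix (R : Type*) [Semiring R] (E : Type) [Fintype E] :
    (IsoClass → R) →ₗ[R] Matrix (Setoid E) (Setoid E) R where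
  toFun f := Matrix.of fun p q => ∑ Z with AgreeOff Z p q, f (cls (induce ⟨p, q⟩ Z))
  map_add' _ _ := Matrix.ext fun _ _ => Finset.sum_add_distrib
  map_smul' _ _ := Matrix.ext fun _ _ => (Finset.mul_sum _ _ _).symm

theorem extMatrix_apply (f : IsoClass → R) (p q : Setoid E) :
    extMatrix R E f p q = ∑ Z with AgreeOff Z p q, f (cls (induce ⟨p, q⟩ Z)) := rfl

theorem extMatrix_apply_of_forall_lt {f : IsoClass → R}
    (hf : ∀ c : IsoClass, c.1 < Nat.card E → f c = 0) (p q : Setoid E) :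
    extMatrix R E f p q = f (cls ⟨p, q⟩) := by
  rw [extMatrix_apply, ← cls_induce_univ]
  refine Finset.sum_eq_single_of_mem Set.univ
    (Finset.mem_filter.2 ⟨Finset.mem_univ _, agreeOff_univ p q⟩) fun Z _ hZ => hf _ ?_
  exact (Set.ncard_lt_ncard (Set.ssubset_univ_iff.2 hZ)).trans_eq (Set.ncard_univ E)

theorem eq_zero_of_extMatrix_eq_zero {f : IsoClass → R}
    (h : ∀ n, extMatrix R (Fin n) f = 0) : f = 0 := by
  suffices ∀ n (c : BipClass n), f ⟨n, c⟩ = 0 from funext fun c => this c.1 c.2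
  intro n
  induction n using Nat.strong_induction_on with
  | _ n ih =>
    intro c
    obtain ⟨Γ, rfl⟩ := BipClass.mk_surjective c
    rw [← cls_mk, ← extMatrix_apply_of_forall_lt fun c hc => ih c.1 (by simpa using hc) c.2, h]
    rfl

open Classical in
/-- The triples `(q, X, Y)` of a partition and two sets with union `Z` such that `p`, `q` agree off
`X` and `q`, `r` agree off `Y`. -/
def overlaps (p r : Setoid E) (Z : Set E) : Finset (Setoid E × Set E × Set E) :=
  {t | (AgreeOff t.2.1 p t.1 ∧ AgreeOff t.2.2 t.1 r) ∧ t.2.1 ∪ t.2.2 = Z}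

theorem mem_overlaps {p q r : Setoid E} {X Y Z : Set E} :
    (q, X, Y) ∈ overlaps p r Z ↔ (AgreeOff X p q ∧ AgreeOff Y q r) ∧ X ∪ Y = Z :=
  Finset.mem_filter_univ _

theorem comap_mem_overlaps {p q r : Setoid E} {X Y : Set E} [Fintype D] {i : D → E}
    (h : (q, X, Y) ∈ overlaps p r (Set.range i)) :
    (q.comap i, i ⁻¹' X, i ⁻¹' Y) ∈ overlaps (p.comap i) (r.comap i) Set.univ := by
  obtain ⟨⟨hX, hY⟩, hXY⟩ := mem_overlaps.1 h
  refine mem_overlaps.2 ⟨⟨hX.comap i, hY.comap i⟩, ?_⟩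
  rw [← Set.preimage_union, hXY, Set.preimage_range]

theorem extend_mem_overlaps {p r : Setoid E} [Fintype D] {i : D → E} (hi : Function.Injective i)
    (hpr : AgreeOff (Set.range i) p r) {q : Setoid D} {X Y : Set D}
    (h : (q, X, Y) ∈ overlaps (p.comap i) (r.comap i) Set.univ) :
    (extendSetoid p i q, i '' X, i '' Y) ∈ overlaps p r (Set.range i) := by
  obtain ⟨⟨hX, hY⟩, hXY⟩ := mem_overlaps.1 h
  have hpq := agreeOff_extendSetoid hi hpr.saturated q
  refine mem_overlaps.2 ⟨⟨hpq.of_comap (Set.image_subset_range _ _) ?_,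
    (hpq.symm.trans hpr).of_comap (Set.image_subset_range _ _) ?_⟩, ?_⟩
  · rwa [extendSetoid_comap hi, Set.preimage_image_eq X hi]
  · rwa [extendSetoid_comap hi, Set.preimage_image_eq Y hi]
  · rw [← Set.image_union, hXY, Set.image_univ]

/-- The sum of `f(p, q)|_X · g(q, r)|_Y` over the triples `(q, X, Y)` in `overlaps p r Z`. -/
def overlapSum (f g : IsoClass → R) (p r : Setoid E) (Z : Set E) : R :=
  ∑ t ∈ overlaps p r Z, f (cls (induce ⟨p, t.1⟩ t.2.1)) * g (cls (induce ⟨t.1, r⟩ t.2.2))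

theorem overlapSum_range [Fintype D] (f g : IsoClass → R) {p r : Setoid E} {i : D → E}
    (hi : Function.Injective i) (h : AgreeOff (Set.range i) p r) :
    overlapSum f g p r (Set.range i) = overlapSum f g (p.comap i) (r.comap i) Set.univ := by
  refine Finset.sum_nbij' (fun t => (t.1.comap i, i ⁻¹' t.2.1, i ⁻¹' t.2.2))
    (fun t => (extendSetoid p i t.1, i '' t.2.1, i '' t.2.2))
    (fun _ => comap_mem_overlaps) (fun _ => extend_mem_overlaps hi h) ?_ ?_ ?_
  · rintro ⟨q, X, Y⟩ ht
    obtain ⟨⟨hX, hY⟩, hXY⟩ := mem_overlaps.1 ht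
    refine Prod.ext ?_ (Prod.ext ?_ ?_)
    · exact (agreeOff_extendSetoid hi h.saturated _).eq_of_comap_eq (hXY ▸ hX.union_left hY)
        (extendSetoid_comap hi p _)
    · exact Set.image_preimage_eq_of_subset (hXY ▸ Set.subset_union_left)
    · exact Set.image_preimage_eq_of_subset (hXY ▸ Set.subset_union_right)
  · rintro ⟨q, X, Y⟩ _
    exact Prod.ext (extendSetoid_comap hi p q)
      (Prod.ext (Set.preimage_image_eq X hi) (Set.preimage_image_eq Y hi))
  · rintro ⟨q, X, Y⟩ ht
    obtain ⟨-, hXY⟩ := mem_overlaps.1 ht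
    exact congrArg₂ (fun c d => f c * g d)
      (cls_induce_comap ⟨p, q⟩ hi (hXY ▸ Set.subset_union_left)).symm
      (cls_induce_comap ⟨q, r⟩ hi (hXY ▸ Set.subset_union_right)).symm

theorem extMatrix_mul_extMatrix_apply (f g : IsoClass → R) (p r : Setoid E) :
    (extMatrix R E f * extMatrix R E g) p r = ∑ Z with AgreeOff Z p r, overlapSum f g p r Z := by
  classical
  have overlapSum_eq_zero : ∀ Z ∈ univ, overlapSum f g p r Z ≠ 0 → AgreeOff Z p r := by
    intro Z _ hZ
    obtain ⟨⟨q, X, Y⟩, ht, -⟩ := Finset.exists_ne_zero_of_sum_ne_zero hZ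
    obtain ⟨⟨hX, hY⟩, rfl⟩ := mem_overlaps.1 ht
    exact hX.union hY
  rw [Finset.sum_filter_of_ne overlapSum_eq_zero]
  calc (extMatrix R E f * extMatrix R E g) p r
      = ∑ q, (∑ X with AgreeOff X p q, f (cls (induce ⟨p, q⟩ X))) *
          ∑ Y with AgreeOff Y q r, g (cls (induce ⟨q, r⟩ Y)) := rfl
    _ = ∑ q, ∑ u : Set E × Set E with AgreeOff u.1 p q ∧ AgreeOff u.2 q r,
          f (cls (induce ⟨p, q⟩ u.1)) * g (cls (induce ⟨q, r⟩ u.2)) := by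
        simp only [Finset.sum_mul_sum, ← Finset.sum_product', ← Finset.filter_product,
          Finset.univ_product_univ]
    _ = ∑ t : Setoid E × Set E × Set E with AgreeOff t.2.1 p t.1 ∧ AgreeOff t.2.2 t.1 r,
          f (cls (induce ⟨p, t.1⟩ t.2.1)) * g (cls (induce ⟨t.1, r⟩ t.2.2)) := by
        simp only [Finset.sum_filter, Fintype.sum_prod_type]
    _ = ∑ Z, overlapSum f g p r Z := by
        refine (Finset.sum_fiberwise _
          (fun t : Setoid E × Set E × Set E => t.2.1 ∪ t.2.2) _).symm.trans ?_
        simp only [overlapSum, overlaps, Finset.filter_filter]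

/-- The product of functions of isomorphism classes that the matrix product induces under
`extMatrix`: its value at a graph `(p, r)` collects the products of the values at edge sets `X` of
`(p, q)` and `Y` of `(q, r)` that together cover all edges. -/
def overlapMul (f g : IsoClass → R) (c : IsoClass) : R :=
  let Γ := Quotient.out (s := isoSetoid c.1) c.2
  overlapSum f g Γ.left Γ.right Set.univ

theorem overlapMul_cls (f g : IsoClass → R) (Γ : BipGraph E) :
    overlapMul f g (cls Γ) = overlapSum f g Γ.left Γ.right Set.univ := by
  let Δ := Quotient.out (s := isoSetoid (cls Γ).1) (cls Γ).2
  have hΔ : cls Δ = cls Γ := (cls_mk Δ).trans (Sigma.ext rfl (heq_of_eq (Quotient.out_eq _)))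
  obtain ⟨a, ha⟩ := cls_eq_iff.1 hΔ
  have h := overlapSum_range f g a.injective (a.surjective.range_eq ▸ agreeOff_univ Γ.left Γ.right)
  rw [a.surjective.range_eq] at h
  obtain ⟨hl, hr⟩ := eq_iff_left_right.1 (isIso_iff.1 ha)
  rw [h]
  exact congrArg₂ (overlapSum f g · · Set.univ) hl hr

theorem extMatrix_overlapMul (f g : IsoClass → R) :
    extMatrix R E (overlapMul f g) = extMatrix R E f * extMatrix R E g := by
  classical
  ext p r
  rw [extMatrix_mul_extMatrix_apply, extMatrix_apply]
  refine Finset.sum_congr rfl fun Z hZ => ?_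
  have hZ' : AgreeOff (Set.range ((↑) : Z → E)) p r :=
    Subtype.range_coe.symm ▸ (Finset.mem_filter.1 hZ).2
  have h := overlapSum_range f g Subtype.val_injective hZ'
  rw [Subtype.range_coe] at h
  rw [h]
  exact overlapMul_cls f g _

theorem exists_of_overlapMul_ne_zero {f g : IsoClass → R} {e : IsoClass}
    (h : overlapMul f g e ≠ 0) :
    ∃ c d, f c ≠ 0 ∧ g d ≠ 0 ∧ max c.1 d.1 ≤ e.1 ∧ e.1 ≤ c.1 + d.1 := by
  obtain ⟨⟨q, X, Y⟩, ht, hne⟩ := Finset.exists_ne_zero_of_sum_ne_zero h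
  obtain ⟨-, hXY⟩ := mem_overlaps.1 ht
  have card_le : ∀ Z : Set (Fin e.1), Nat.card Z ≤ e.1 := fun Z =>
    (Finite.card_subtype_le _).trans_eq (Nat.card_fin _)
  refine ⟨_, _, left_ne_zero_of_mul hne, right_ne_zero_of_mul hne,
    max_le (card_le X) (card_le Y), ?_⟩
  calc e.1 = (X ∪ Y).ncard := by rw [hXY, Set.ncard_univ, Nat.card_fin]
    _ ≤ X.ncard + Y.ncard := Set.ncard_union_le X Y

end Extension

section StandardExtensions

namespace BipGraph

section DisjUnion

variable {E D D' : Type}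

open Classical in
/-- The bijection onto `E` that is given by bijections onto a set and onto its complement. -/
def ontoCompl (u : Σ Z : Set E, (D ≃ Z) × (D' ≃ (Zᶜ : Set E))) : D ⊕ D' ≃ E :=
  (u.2.1.sumCongr u.2.2).trans (Equiv.Set.sumCompl u.1)

theorem range_ontoCompl_inl (u : Σ Z : Set E, (D ≃ Z) × (D' ≃ (Zᶜ : Set E))) :
    Set.range (ontoCompl u ∘ Sum.inl) = u.1 := by
  obtain ⟨Z, a, b⟩ := u
  exact (EquivLike.range_comp ((↑) : Z → E) a).trans Subtype.range_coe

theorem ontoCompl_injective :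
    Function.Injective (ontoCompl : (Σ Z : Set E, (D ≃ Z) × (D' ≃ (Zᶜ : Set E))) → _) := by
  rintro ⟨Z, a, b⟩ ⟨Z', a', b'⟩ h
  obtain rfl : Z = Z' :=
    (range_ontoCompl_inl ⟨Z, a, b⟩).symm.trans (h ▸ range_ontoCompl_inl ⟨Z', a', b'⟩)
  have hab := Equiv.ext_iff.1 h
  congr 2
  · exact Equiv.ext fun d => Subtype.ext (hab (Sum.inl d))
  · exact Equiv.ext fun d => Subtype.ext (hab (Sum.inr d))

theorem ontoCompl_surjective :
    Function.Surjective (ontoCompl : (Σ Z : Set E, (D ≃ Z) × (D' ≃ (Zᶜ : Set E))) → _) := by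
  intro c
  have hl : Function.Injective (c ∘ Sum.inl) := c.injective.comp Sum.inl_injective
  have hr : Function.Injective (c ∘ Sum.inr) := c.injective.comp Sum.inr_injective
  have hc : Set.range (c ∘ Sum.inr) = (Set.range (c ∘ Sum.inl))ᶜ := by
    rw [Set.range_comp, Set.range_comp, ← Set.image_compl_eq c.bijective, Set.compl_range_inl]
  refine ⟨⟨Set.range (c ∘ Sum.inl), Equiv.ofInjective _ hl,
    (Equiv.ofInjective _ hr).trans (Equiv.setCongr hc)⟩, Equiv.ext ?_⟩
  rintro (d | d) <;> rfl

theorem ker_sumMap_eq_comap_iff {s : Setoid E} {u : Setoid D} {v : Setoid D'} {Z : Set E}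
    (a : D ≃ Z) (b : D' ≃ (Zᶜ : Set E)) :
    Setoid.ker (Sum.map (Quotient.mk u) (Quotient.mk v)) = s.comap (ontoCompl ⟨Z, a, b⟩) ↔
      Saturated s Z ∧ u = (s.comap Subtype.val).comap a ∧ v = (s.comap Subtype.val).comap b := by
  simp only [Setoid.ext_iff, Setoid.ker_def, Setoid.comap_rel, Sum.forall, Sum.map_inl,
    Sum.map_inr, ontoCompl, Equiv.trans_apply, Equiv.sumCongr_apply, Sum.inl.injEq, Sum.inr.injEq,
    reduceCtorEq, false_iff, Equiv.Set.sumCompl_apply_inl, Equiv.Set.sumCompl_apply_inr,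
    Quotient.eq]
  constructor
  · intro h
    have mem_of_rel : ∀ ⦃e f⦄, s e f → e ∈ Z → f ∈ Z := fun e f hef he => by
      by_contra hf
      obtain ⟨x, hx⟩ := a.surjective ⟨e, he⟩
      obtain ⟨y, hy⟩ := b.surjective ⟨f, hf⟩
      exact (h.1 x).2 y (by rwa [hx, hy])
    exact ⟨fun e f hef => ⟨mem_of_rel hef, mem_of_rel (s.symm hef)⟩,
      fun x y => (h.1 x).1 y, fun x y => (h.2 x).2 y⟩
  · rintro ⟨hs, hu, hv⟩
    exact ⟨fun x => ⟨hu x, fun y hxy => (b y).2 ((hs hxy).1 (a x).2)⟩,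
      fun x => ⟨fun y hxy => (b x).2 ((hs hxy).2 (a y).2), hv x⟩⟩

theorem disjUnion_isIso_iff {Γ : BipGraph D} {S : BipGraph D'} {Δ : BipGraph E} {Z : Set E}
    (a : D ≃ Z) (b : D' ≃ (Zᶜ : Set E)) :
    (Γ.disjUnion S).IsIso Δ (ontoCompl ⟨Z, a, b⟩) ↔
      (Saturated Δ.left Z ∧ Saturated Δ.right Z) ∧
        Γ.IsIso (Δ.induce Z) a ∧ S.IsIso (Δ.induce Zᶜ) b := by
  simp only [isIso_iff, eq_iff_left_right, induce, comap_left, comap_right]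
  refine (and_congr (ker_sumMap_eq_comap_iff a b) (ker_sumMap_eq_comap_iff a b)).trans ?_
  tauto

theorem isoCount_disjUnion [Fintype E] (Γ : BipGraph D) (S : BipGraph D') (Δ : BipGraph E) :
    isoCount (Γ.disjUnion S) Δ = ∑ Z : Set E with Saturated Δ.left Z ∧ Saturated Δ.right Z,
      isoCount Γ (Δ.induce Z) * isoCount S (Δ.induce Zᶜ) := by
  let ι := {Z : Set E // Saturated Δ.left Z ∧ Saturated Δ.right Z}
  let f (u : Σ Z : ι, {a : D ≃ Z.1 // Γ.IsIso (Δ.induce Z.1) a} ×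
      {b : D' ≃ (Z.1ᶜ : Set E) // S.IsIso (Δ.induce Z.1ᶜ) b}) :
      {c : D ⊕ D' ≃ E // (Γ.disjUnion S).IsIso Δ c} :=
    ⟨ontoCompl ⟨u.1.1, u.2.1.1, u.2.2.1⟩,
      (disjUnion_isIso_iff _ _).2 ⟨u.1.2, u.2.1.2, u.2.2.2⟩⟩
  have hf : Function.Bijective f := by
    constructor
    · rintro ⟨⟨Z, hZ⟩, ⟨a, ha⟩, ⟨b, hb⟩⟩ ⟨⟨Z', hZ'⟩, ⟨a', ha'⟩, ⟨b', hb'⟩⟩ h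
      obtain ⟨⟩ := ontoCompl_injective (congrArg Subtype.val h)
      rfl
    · rintro ⟨c, hc⟩
      obtain ⟨⟨Z, a, b⟩, rfl⟩ := ontoCompl_surjective c
      obtain ⟨hZ, ha, hb⟩ := (disjUnion_isIso_iff a b).1 hc
      exact ⟨⟨⟨Z, hZ⟩, ⟨a, ha⟩, ⟨b, hb⟩⟩, rfl⟩
  calc isoCount (Γ.disjUnion S) Δ = Nat.card (Σ Z : ι, _) :=
        (Nat.card_congr (Equiv.ofBijective f hf)).symm
    _ = ∑ Z : ι, isoCount Γ (Δ.induce Z) * isoCount S (Δ.induce Zᶜ) :=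
        Nat.card_sigma.trans (Finset.sum_congr rfl fun Z _ => Nat.card_prod _ _)
    _ = _ := (Finset.sum_subtype _ (fun Z => Finset.mem_filter_univ Z)
        fun Z => isoCount Γ (Δ.induce Z) * isoCount S (Δ.induce Zᶜ)).symm

end DisjUnion

variable {E : Type}

theorem isSimple_iff {Γ : BipGraph E} : Γ.IsSimple ↔ Γ.left = Γ.right := by
  simp only [IsSimple, end₁_eq, end₂_eq]
  constructor
  · intro h
    refine le_antisymm (fun e f hef => (h e f ?_).2) fun e f hef => (h e f ?_).1
    · exact (le_sup_left : Γ.left ≤ Γ.left ⊔ Γ.right) hef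
    · exact (le_sup_right : Γ.right ≤ Γ.left ⊔ Γ.right) hef
  · intro h e f hef
    rw [← h, sup_idem] at hef
    exact ⟨hef, h ▸ hef⟩

theorem agreeOff_iff {Γ : BipGraph E} {Z : Set E} : AgreeOff Z Γ.left Γ.right ↔
    (Saturated Γ.left Z ∧ Saturated Γ.right Z) ∧ (Γ.induce Zᶜ).IsSimple := by
  rw [isSimple_iff, Setoid.ext_iff]
  refine ⟨fun h => ⟨⟨h.saturated, h.saturated_right⟩, fun e f => h.rel_iff e.2 f⟩, ?_⟩
  rintro ⟨⟨hl, hr⟩, h⟩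
  refine ⟨hl, fun e he f => ?_⟩
  by_cases hf : f ∈ Z
  · exact iff_of_false (fun hef => he ((hl hef).2 hf)) fun hef => he ((hr hef).2 hf)
  · exact h ⟨e, he⟩ ⟨f, hf⟩

open Classical in
theorem sum_isSimple_single_apply [Finite E] {k : ℕ} (hk : Nat.card E = k) (Γ : BipGraph E) :
    ∑ S : BipClass k with S.IsSimple, Finsupp.single (⟨k, S⟩ : IsoClass) (1 : ℂ) (cls Γ) =
      if Γ.IsSimple then 1 else 0 := by
  subst hk
  let T : BipClass (Nat.card E) := BipClass.mk (Γ.relabel (Finite.equivFin E))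
  have hT : T.IsSimple ↔ Γ.IsSimple :=
    ⟨fun h => h.of_iso (relabel_isIso _ _).symm, fun h => h.of_iso (relabel_isIso _ _)⟩
  have hsingle : ∀ S, Finsupp.single (⟨_, S⟩ : IsoClass) (1 : ℂ) (cls Γ) =
      if S = T then 1 else 0 := fun S =>
    (Finsupp.single_apply_left sigma_mk_injective S T 1).trans Finsupp.single_apply
  simp only [hsingle, Finset.sum_ite_eq', Finset.mem_filter_univ, hT]

end BipGraph

theorem single_extend_apply {m n : ℕ} (h : m ≤ n) (c : BipClass m) (d : BipClass (n - m))
    (Δ : BipGraph (Fin n)) :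
    Finsupp.single (c.extend h d) ((c.extend h d).autCard / (c.autCard * d.autCard) : ℂ)
        (BipClass.mk Δ) =
      ∑ Z : Set (Fin n) with Saturated Δ.left Z ∧ Saturated Δ.right Z,
        Finsupp.single (⟨m, c⟩ : IsoClass) (1 : ℂ) (cls (Δ.induce Z)) *
          Finsupp.single (⟨n - m, d⟩ : IsoClass) (1 : ℂ) (cls (Δ.induce Zᶜ)) := by
  obtain ⟨Γ, rfl⟩ := BipClass.mk_surjective c
  obtain ⟨S, rfl⟩ := BipClass.mk_surjective d
  let Θ := (Γ.disjUnion S).relabel (sumEquiv h)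
  have hΘ : (Γ.disjUnion S).IsIso Θ (sumEquiv h) := relabel_isIso _ _
  have autCard_ne_zero : ((Γ.disjUnion S).autCard : ℂ) ≠ 0 := mod_cast autCard_pos _ |>.ne'
  calc Finsupp.single (BipClass.mk Θ) (Θ.autCard / (Γ.autCard * S.autCard) : ℂ) (BipClass.mk Δ)
      = Finsupp.single (cls (Γ.disjUnion S))
          ((Γ.disjUnion S).autCard / (Γ.autCard * S.autCard) : ℂ) (cls Δ) := by
        rw [single_mk_apply, ← cls_mk, ← cls_eq_iff.2 ⟨_, hΘ⟩, autCard_congr hΘ]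
    _ = isoCount (Γ.disjUnion S) Δ / (Γ.autCard * S.autCard) := by
        rw [single_cls_apply]
        field_simp
    _ = _ := by
        rw [isoCount_disjUnion, Nat.cast_sum, Finset.sum_div]
        refine Finset.sum_congr rfl fun Z _ => ?_
        rw [← cls_mk, ← cls_mk, single_cls_apply, single_cls_apply, Nat.cast_mul]
        ring

theorem classRho_apply {m n : ℕ} (h : m ≤ n) (c : BipClass m) (Δ : BipGraph (Fin n)) :
    classRho h c (BipClass.mk Δ) = ∑ Z with AgreeOff Z Δ.left Δ.right,
      Finsupp.single (⟨m, c⟩ : IsoClass) (1 : ℂ) (cls (Δ.induce Z)) := by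
  classical
  have sum_compl : ∀ Z : Set (Fin n),
      ∑ d : BipClass (n - m) with d.IsSimple,
        Finsupp.single (⟨m, c⟩ : IsoClass) (1 : ℂ) (cls (Δ.induce Z)) *
          Finsupp.single (⟨n - m, d⟩ : IsoClass) (1 : ℂ) (cls (Δ.induce Zᶜ)) =
      if (Δ.induce Zᶜ).IsSimple then
        Finsupp.single (⟨m, c⟩ : IsoClass) (1 : ℂ) (cls (Δ.induce Z)) else 0 := by
    intro Z
    rw [← Finset.mul_sum]
    by_cases hZ : cls (Δ.induce Z) = ⟨m, c⟩
    · have hm : Z.ncard = m := congrArg Sigma.fst hZ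
      have hcard : Nat.card (Zᶜ : Set (Fin n)) = n - m := by
        rw [Nat.card_coe_set_eq, Set.ncard_compl, hm, Nat.card_fin]
      rw [sum_isSimple_single_apply hcard, mul_ite, mul_one, mul_zero]
    · rw [Finsupp.single_eq_of_ne hZ, zero_mul, ite_self]
  rw [classRho, Finsupp.finsetSum_apply,
    Finset.sum_congr rfl fun d _ => single_extend_apply h c d Δ, Finset.sum_comm,
    Finset.sum_congr rfl fun Z _ => sum_compl Z, ← Finset.sum_filter, Finset.filter_filter]
  exact Finset.sum_congr (Finset.filter_congr fun _ _ => agreeOff_iff.symm) fun _ _ => rfl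

theorem incl_single {n : ℕ} (c : BipClass n) (z : ℂ) :
    incl n (Finsupp.single c z) = Finsupp.single ⟨n, c⟩ z :=
  Finsupp.mapDomain_single

theorem toMatrix_rho {m n : ℕ} (x : B m) :
    toMatrix n (rho m n x) = extMatrix ℂ (Fin n) (incl m x) := by
  suffices toMatrix n ∘ₗ rho m n =
      extMatrix ℂ (Fin n) ∘ₗ Finsupp.lcoeFun ∘ₗ incl m from LinearMap.congr_fun this x
  ext c p q
  simp only [LinearMap.coe_comp, Function.comp_apply, Finsupp.lsingle_apply, toMatrix_apply,
    incl_single, rho]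
  rw [extMatrix_apply]
  split_ifs with h
  · simp only [Finsupp.lift_apply, zero_smul, Finsupp.sum_single_index, one_smul]
    exact classRho_apply h c _
  · refine (Finset.sum_eq_zero fun Z _ => Finsupp.single_eq_of_ne fun hZ => h ?_).symm
    have hm : Z.ncard = m := congrArg Sigma.fst hZ
    exact hm ▸ (Set.ncard_le_card _).trans_eq (Nat.card_fin n)

end StandardExtensions

section Product

variable {m₁ m₂ n : ℕ} (Γ₁ : BipClass m₁) (Γ₂ : BipClass m₂)

theorem sum_incl_apply (s : Finset ℕ) (x : ∀ n, B n) (c : IsoClass) :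
    (∑ k ∈ s, incl k (x k)) c = if c.1 ∈ s then x c.1 c.2 else 0 := by
  have incl_apply : ∀ k, incl k (x k) c = if c.1 = k then x c.1 c.2 else 0 := by
    intro k
    split_ifs with h
    · subst h
      exact Finsupp.mapDomain_apply sigma_mk_injective _ c.2
    · refine Finsupp.mapDomain_of_notMem_range _ _ ?_
      rintro ⟨d, rfl⟩
      exact h rfl
  rw [Finsupp.finsetSum_apply, Finset.sum_congr rfl fun k _ => incl_apply k, Finset.sum_ite_eq]

theorem overlapMul_single_eq_zero {R : Type*} [Semiring R] {c d e : IsoClass} {z w : R}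
    (h : e.1 < max c.1 d.1 ∨ c.1 + d.1 < e.1) :
    overlapMul (Finsupp.single c z) (Finsupp.single d w) e = 0 := by
  by_contra hne
  obtain ⟨c', d', hc, hd, hmax, hadd⟩ := exists_of_overlapMul_ne_zero hne
  obtain rfl : c' = c := of_not_not fun h => hc (Finsupp.single_eq_of_ne h)
  obtain rfl : d' = d := of_not_not fun h => hd (Finsupp.single_eq_of_ne h)
  exact h.elim hmax.not_gt hadd.not_gt

theorem toMatrix_bracket (h : max m₁ m₂ ≤ n) :
    toMatrix n (bracket Γ₁ Γ₂ n) = extMatrix ℂ (Fin n)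
      (overlapMul (Finsupp.single ⟨m₁, Γ₁⟩ 1) (Finsupp.single ⟨m₂, Γ₂⟩ 1) -
        ⇑(∑ k ∈ Ico (max m₁ m₂) n, incl k (bracket Γ₁ Γ₂ k))) := by
  rw [bracket, if_neg h.not_gt, map_sub, map_sub, starMul, toMatrix_mul, toMatrix_rho,
    toMatrix_rho, incl_single, incl_single, extMatrix_overlapMul,
    Finset.sum_attach _ fun k => rho k n (bracket Γ₁ Γ₂ k), map_sum, Finsupp.coe_finsetSum, map_sum]
  simp only [toMatrix_rho]

theorem bracket_apply (c : BipClass n) : bracket Γ₁ Γ₂ n c =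
    overlapMul (Finsupp.single ⟨m₁, Γ₁⟩ 1) (Finsupp.single ⟨m₂, Γ₂⟩ 1) ⟨n, c⟩ := by
  induction n using Nat.strong_induction_on with
  | _ n ih =>
    rcases lt_or_ge n (max m₁ m₂) with hn | hn
    · rw [overlapMul_single_eq_zero (Or.inl hn), bracket, if_pos hn, Finsupp.coe_zero,
        Pi.zero_apply]
    obtain ⟨Γ, rfl⟩ := BipClass.mk_surjective c
    let F := overlapMul (Finsupp.single (⟨m₁, Γ₁⟩ : IsoClass) (1 : ℂ))
      (Finsupp.single (⟨m₂, Γ₂⟩ : IsoClass) (1 : ℂ))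
    let S : BInf := ∑ k ∈ Ico (max m₁ m₂) n, incl k (bracket Γ₁ Γ₂ k)
    have eq_below : ∀ c : IsoClass, c.1 < Nat.card (Fin n) → (F - ⇑S) c = 0 := by
      intro c hc
      rw [Nat.card_fin] at hc
      rw [Pi.sub_apply, sum_incl_apply, sub_eq_zero]
      split_ifs with hmem
      · exact (ih c.1 hc c.2).symm
      · exact overlapMul_single_eq_zero
          (Or.inl (not_le.1 fun h => hmem (Finset.mem_Ico.2 ⟨h, hc⟩)))
    calc bracket Γ₁ Γ₂ n (BipClass.mk Γ) = toMatrix n (bracket Γ₁ Γ₂ n) Γ.left Γ.right := rfl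
      _ = (F - ⇑S) (cls Γ) := by
        rw [toMatrix_bracket Γ₁ Γ₂ hn, extMatrix_apply_of_forall_lt eq_below]
      _ = F ⟨n, BipClass.mk Γ⟩ := by
        rw [cls_mk, Pi.sub_apply, sum_incl_apply, if_neg Finset.right_notMem_Ico, sub_zero]

theorem bracket_eq_zero (h : m₁ + m₂ < n) : bracket Γ₁ Γ₂ n = 0 :=
  Finsupp.ext fun c => (bracket_apply Γ₁ Γ₂ c).trans (overlapMul_single_eq_zero (Or.inr h))

theorem classCirc_eq_sum :
    classCirc Γ₁ Γ₂ = ∑ n ∈ Icc (max m₁ m₂) (m₁ + m₂), incl n (bracket Γ₁ Γ₂ n) := by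
  refine finsum_mem_eq_sum_of_inter_support_eq (s := Set.Ici (max m₁ m₂)) _ (Set.ext fun n => ?_)
  rw [Finset.coe_Icc]
  refine and_congr_left fun hn => ⟨fun h => ⟨h, not_lt.1 fun hlt => hn ?_⟩, And.left⟩
  exact (congrArg (incl n) (bracket_eq_zero Γ₁ Γ₂ hlt)).trans (map_zero _)

theorem coe_classCirc : ⇑(classCirc Γ₁ Γ₂) =
    overlapMul (Finsupp.single ⟨m₁, Γ₁⟩ 1) (Finsupp.single ⟨m₂, Γ₂⟩ 1) := by
  funext c
  rw [classCirc_eq_sum, sum_incl_apply]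
  split_ifs with h
  · exact bracket_apply Γ₁ Γ₂ c.2
  · refine (overlapMul_single_eq_zero ?_).symm
    rwa [Finset.mem_Icc, not_and_or, not_le, not_le] at h

theorem extMatrix_circ (n : ℕ) (x y : BInf) :
    extMatrix ℂ (Fin n) (circ x y) = extMatrix ℂ (Fin n) x * extMatrix ℂ (Fin n) y := by
  let φ : BInf →ₗ[ℂ] Matrix (Setoid (Fin n)) (Setoid (Fin n)) ℂ :=
    extMatrix ℂ (Fin n) ∘ₗ Finsupp.lcoeFun
  suffices circ.compr₂ φ = (LinearMap.mul ℂ (Matrix _ _ ℂ)).compl₁₂ φ φ from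
    LinearMap.congr_fun₂ this x y
  refine Finsupp.lhom_ext' fun c => LinearMap.ext_ring ?_
  refine Finsupp.lhom_ext' fun d => LinearMap.ext_ring ?_
  simp only [circ, LinearMap.coe_comp, Function.comp_apply, Finsupp.lsingle_apply,
    LinearMap.compr₂_apply, Finsupp.lift_apply, zero_smul, Finsupp.sum_single_index, one_smul,
    Finsupp.lcoeFun_apply, LinearMap.compl₁₂_apply, LinearMap.mul_apply_apply, φ]
  rw [coe_classCirc, extMatrix_overlapMul]

theorem circ_assoc (x y z : BInf) : circ (circ x y) z = circ x (circ y z) := by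
  refine sub_eq_zero.1 (DFunLike.coe_injective (eq_zero_of_extMatrix_eq_zero (R := ℂ) fun n => ?_))
  rw [Finsupp.coe_sub, map_sub, sub_eq_zero]
  simp only [extMatrix_circ, Matrix.mul_assoc]

end Product

end BipartiteGraphs

end

theorem lemma3 :
    (∀ a b c : BipartiteGraphs.BInf,
      BipartiteGraphs.circ (BipartiteGraphs.circ a b) c =
        BipartiteGraphs.circ a (BipartiteGraphs.circ b c)) ∧
    (∀ (m₁ m₂ : ℕ) (Γ₁ : BipartiteGraphs.BipClass m₁) (Γ₂ : BipartiteGraphs.BipClass m₂) (n : ℕ),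
      m₁ + m₂ < n → BipartiteGraphs.bracket Γ₁ Γ₂ n = 0) :=
  ⟨BipartiteGraphs.circ_assoc, fun _ _ Γ₁ Γ₂ _ h => BipartiteGraphs.bracket_eq_zero Γ₁ Γ₂ h⟩
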